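/- Let $\log$ denote the logarithm to base $2$. For a bipartite state $\rho$ on $A\otimes B$ (finite-dimensional), let $$I_c(\rho)=\max_{M_A\otimes M_B}\bigl[H(p_A)+H(p_B)-H(p_{AB})\bigr],$$ where the maximum is over pairs of POVMs $M_A$, $M_B$ (with finitely many outcomes) on $A$ and $B$, $p_{AB}$ is the joint distribution of the outcomes of $M_A\otimes M_B$ on $\rho$, $p_A,p_B$ are its marginals, and $H$ is the Shannon entropy. Let $$I_c^{(1)}(\rho)=\max_{\Lambda} I_c(\Lambda(\rho)),$$ where $\Lambda$ ranges over the bipartite operations that consist of local quantum operations by Alice and Bob (with arbitrary finite-dimensional output systems) and at most one bit of classical communication, in either direction. Let $d\ge 1$, let $U_0=I$ and let $U_1$ be a $d\times d$ unitary matrix that takes the computational basis to a conjugate basis, i.e. $|\langle i|U_1|k\rangle|=\frac{1}{\sqrt d}$ for all $i,k$. Consider the state on a $2d\times d$-dimensional system $$\rho=\frac{1}{2d}\sum_{k=0}^{d-1}\sum_{t=0}^{1}\bigl(|k\rangle\langle k|\otimes|t\rangle\langle t|\bigr)_A\otimes\bigl(U_t|k\rangle\langle k|U_t^\dagger\bigr)_B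 ,$$ and let $$\rho'=\frac{1}{2d}\sum_{k=0}^{d-1}\sum_{t=0}^{1}\bigl(|k\rangle\langle k|\otimes|t\rangle\langle t|\bigr)_A\otimes\bigl(U_t|k\rangle\langle k|U_t^\dagger\otimes|t\rangle\langle t|\bigr)_B .$$ Then the maxima defining $I_c(\rho)$, $I_c(\rho')$ and $I_c^{(1)}(\rho)$ are attained, and: 1. $I_c(\rho)=\frac12\log d$. 2. $\rho'$ is the state that results from $\rho$ by the one-bit protocol in which Alice sends $t$ to Bob (keeping her copy), and $I_c(\rho')=\log d+1$. 3. $I_c^{(1)}(\rho)=\log d+1$. 4. Consequently $I_c(\rho')-I_c(\rho)=I_c^{(1)}(\rho)-I_c(\rho)=1+\frac12\log d$: one bit of classical communication unlocks $1+\frac12\log d$ bits of classical correlation. -/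

import Mathlib

open scoped Kronecker ComplexOrder

noncomputable section

namespace Locking

/-- A measurement (POVM) with `n` outcomes on the quantum system `ℂ^a`. -/
structure POVM (a : Type) [Fintype a] [DecidableEq a] (n : ℕ) where
  effect : Fin n → Matrix a a ℂ
  posSemidef : ∀ x, (effect x).PosSemidef
  sum_eq_one : ∑ x, effect x = 1

/-- Shannon entropy, in bits, of a finitely supported distribution. -/
def entropy {ι : Type} [Fintype ι] (p : ι → ℝ) : ℝ :=
  -∑ x, p x * Real.logb 2 (p x)

/-- `I(A:B) = H(p_A) + H(p_B) - H(p_AB)` for a joint distribution `p_AB`. -/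
def mutualInfo {ι κ : Type} [Fintype ι] [Fintype κ] (p : ι × κ → ℝ) : ℝ :=
  entropy (fun x => ∑ y, p (x, y)) + entropy (fun y => ∑ x, p (x, y)) - entropy p

section Bipartite

variable {a b : Type} [Fintype a] [DecidableEq a] [Fintype b] [DecidableEq b]

/-- Joint outcome distribution of the local measurement `M ⊗ N` on the bipartite state `ρ`. -/
def outcomeDist (ρ : Matrix (a × b) (a × b) ℂ) {m n : ℕ} (M : POVM a m) (N : POVM b n) :
    Fin m × Fin n → ℝ :=
  fun z => (((M.effect z.1 ⊗ₖ N.effect z.2) * ρ).trace).re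

/-- The values of the classical mutual information that local measurements produce from `ρ`. -/
def localInfoValues (ρ : Matrix (a × b) (a × b) ℂ) : Set ℝ :=
  {v | ∃ (m n : ℕ) (M : POVM a m) (N : POVM b n), mutualInfo (outcomeDist ρ M N) = v}

/-- The classical mutual information `I_c(ρ)` of a bipartite state. -/
def Ic (ρ : Matrix (a × b) (a × b) ℂ) : ℝ :=
  sSup (localInfoValues ρ)

end Bipartite

/-- A quantum instrument from `ℂ^a` to `ℂ^a'` with classical outcome in `ι`, in Kraus form. -/
structure Instrument (ι a a' : Type) [Fintype ι] [Fintype a] [DecidableEq a] [Fintype a'] where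
  rank : ℕ
  kraus : ι → Fin rank → Matrix a' a ℂ
  trace_preserving : ∑ m, ∑ i, (kraus m i).conjTranspose * kraus m i = 1

/-- A quantum channel from `ℂ^a` to `ℂ^a'`, in Kraus form. -/
structure Channel (a a' : Type) [Fintype a] [DecidableEq a] [Fintype a'] where
  rank : ℕ
  kraus : Fin rank → Matrix a' a ℂ
  trace_preserving : ∑ i, (kraus i).conjTranspose * kraus i = 1

/-- Local operations and (at most) one bit of classical communication, in either direction.
The sender's instrument comprises all that the sender does locally, before and after sending
its outcome `m`; the receiver's channel, chosen by `m`, comprises all that the receiver does. -/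
inductive OneBitProtocol (a b a' b' : Type) [Fintype a] [DecidableEq a] [Fintype b]
    [DecidableEq b] [Fintype a'] [Fintype b'] : Type where
  | aliceToBob (S : Instrument (Fin 2) a a') (R : Fin 2 → Channel b b') :
      OneBitProtocol a b a' b'
  | bobToAlice (S : Instrument (Fin 2) b b') (R : Fin 2 → Channel a a') :
      OneBitProtocol a b a' b'

/-- The state `Λ(ρ)` that results from carrying out the protocol on `ρ`. -/
def OneBitProtocol.apply {a b a' b' : Type} [Fintype a] [DecidableEq a] [Fintype b]
    [DecidableEq b] [Fintype a'] [Fintype b'] (P : OneBitProtocol a b a' b')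
    (ρ : Matrix (a × b) (a × b) ℂ) : Matrix (a' × b') (a' × b') ℂ :=
  match P with
  | .aliceToBob S R => ∑ m, ∑ i, ∑ j,
      (S.kraus m i ⊗ₖ (R m).kraus j) * ρ * (S.kraus m i ⊗ₖ (R m).kraus j).conjTranspose
  | .bobToAlice S R => ∑ m, ∑ i, ∑ j,
      ((R m).kraus j ⊗ₖ S.kraus m i) * ρ * ((R m).kraus j ⊗ₖ S.kraus m i).conjTranspose

section OneBit

variable {a b : Type} [Fintype a] [DecidableEq a] [Fintype b] [DecidableEq b]

/-- The values `I_c(Λ(ρ))`, where `Λ` ranges over the one-bit protocols with arbitrary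
finite-dimensional output systems. -/
def oneBitValues (ρ : Matrix (a × b) (a × b) ℂ) : Set ℝ :=
  {v | ∃ (a' b' : Type) (_ : Fintype a') (_ : DecidableEq a') (_ : Fintype b')
    (_ : DecidableEq b') (P : OneBitProtocol a b a' b'), Ic (P.apply ρ) = v}

/-- `I_c^{(1)}(ρ)`: the largest `I_c` that one bit of classical communication achieves. -/
def IcOneBit (ρ : Matrix (a × b) (a × b) ℂ) : ℝ :=
  sSup (oneBitValues ρ)

end OneBit

/-- The projector `|i⟩⟨i|` onto a vector of the computational basis. -/
def ketbra {n : ℕ} (i : Fin n) : Matrix (Fin n) (Fin n) ℂ :=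
  Matrix.single i i 1

/-- `ρ = (1 / 2d) ∑_{k,t} (|k⟩⟨k| ⊗ |t⟩⟨t|)_A ⊗ (U_t |k⟩⟨k| U_t†)_B`. -/
def lockedState (d : ℕ) (U : Fin 2 → Matrix (Fin d) (Fin d) ℂ) :
    Matrix ((Fin d × Fin 2) × Fin d) ((Fin d × Fin 2) × Fin d) ℂ :=
  (1 / (2 * (d : ℂ))) • ∑ k : Fin d, ∑ t : Fin 2,
    (ketbra k ⊗ₖ ketbra t) ⊗ₖ (U t * ketbra k * (U t).conjTranspose)

/-- The state after `t` has been sent: Bob, in addition to his system, holds `|t⟩⟨t|`. -/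
def unlockedState (d : ℕ) (U : Fin 2 → Matrix (Fin d) (Fin d) ℂ) :
    Matrix ((Fin d × Fin 2) × (Fin d × Fin 2)) ((Fin d × Fin 2) × (Fin d × Fin 2)) ℂ :=
  (1 / (2 * (d : ℂ))) • ∑ k : Fin d, ∑ t : Fin 2,
    (ketbra k ⊗ₖ ketbra t) ⊗ₖ ((U t * ketbra k * (U t).conjTranspose) ⊗ₖ ketbra t)

/-- Alice reads her second register `t` in the computational basis, without disturbing it. -/
def readBit (d : ℕ) : Instrument (Fin 2) (Fin d × Fin 2) (Fin d × Fin 2) where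
  rank := 1
  kraus t _ := (1 : Matrix (Fin d) (Fin d) ℂ) ⊗ₖ ketbra t
  trace_preserving := by
    ext ⟨i, s⟩ ⟨j, u⟩
    fin_cases s <;> fin_cases u <;>
      simp [ketbra, Matrix.conjTranspose_kronecker, ← Matrix.mul_kronecker_mul,
        Matrix.single, Matrix.one_apply, Matrix.mul_apply, Matrix.conjTranspose_apply]

/-- Bob stores the bit `t` that he has received in a new register: `|ψ⟩ ↦ |ψ⟩ ⊗ |t⟩`. -/
def storeBit (d : ℕ) (t : Fin 2) : Channel (Fin d) (Fin d × Fin 2) where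
  rank := 1
  kraus _ := Matrix.of fun z j => if z = (j, t) then 1 else 0
  trace_preserving := by
    ext i j
    simp [Matrix.mul_apply, Matrix.one_apply, eq_comm]

/-- The protocol in which Alice sends `t` to Bob. -/
def sendBit (d : ℕ) :
    OneBitProtocol (Fin d × Fin 2) (Fin d) (Fin d × Fin 2) (Fin d × Fin 2) :=
  .aliceToBob (readBit d) (storeBit d)

end Locking

end

/-! The value of `ρ` rests on an entropic uncertainty relation. Alice's part is classical, so by
data processing her best outcome is `(k, t)` itself. For an effect `N` of Bob with trace `τ`, let `q
(k, t)` be the diagonal entry of `U_tᴴ N U_t` at `k`. For each `t` these numbers sum to `τ` over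
`k`. The Maassen–Uffink relation with overlap `1 / √d` gives `∑ q log q ≤ 2τ (log τ - ½ log d)` over
both values of `t`. Hence `N` contributes at most `τ log d / (2d)` to the information, and the
traces `τ` sum to `d`. Computational-basis measurements attain the bound: Bob learns `k` when `t =
0` and nothing when `t = 1`.

The Maassen–Uffink relation is the derivative at the edge of a three-lines interpolation
(`re_sum_mul_le_of_norm_exp_sum_le`, `sum_mul_log_add_sum_mul_log_le`).

The one-bit bound is a domination argument. Since `F ≤ (tr F) 1` for positive `F`, the joint
distribution is at most `2d` times a product distribution, whichever way the bit travels, and so the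
information is at most `log (2d)` (`mutualInfo_le_logb`, `mutualInfo_le_of_shared_bit`). As `ρ'` is
the output of a one-bit protocol, the same bound covers it. Knowing `t`, Bob measures in the right
basis and attains it. -/

namespace Locking

open Finset

/-! ### Classical inequalities for mutual information -/

section MutualInformation

variable {ι κ : Type} [Fintype ι] [Fintype κ]

theorem mutualInfo_eq (p : ι × κ → ℝ) :
    mutualInfo p = (∑ x, ∑ y, p (x, y) * (Real.log (p (x, y)) - Real.log (∑ y', p (x, y')) -
      Real.log (∑ x', p (x', y)))) / Real.log 2 := by
  have h1 : ∑ x, (∑ y, p (x, y)) * Real.log (∑ y, p (x, y)) =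
      ∑ x, ∑ y, p (x, y) * Real.log (∑ y', p (x, y')) :=
    sum_congr rfl fun x _ => sum_mul ..
  have h2 : ∑ y, (∑ x, p (x, y)) * Real.log (∑ x, p (x, y)) =
      ∑ x, ∑ y, p (x, y) * Real.log (∑ x', p (x', y)) := by
    rw [sum_comm]
    exact sum_congr rfl fun y _ => sum_mul ..
  simp only [mutualInfo, entropy, Real.logb, mul_div_assoc', ← sum_div, h1, h2,
    Fintype.sum_prod_type, mul_sub, sum_sub_distrib]
  ring

theorem mutualInfo_comp_equiv {ι' κ' : Type} [Fintype ι'] [Fintype κ'] (e : ι' ≃ ι) (f : κ' ≃ κ)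
    (p : ι × κ → ℝ) : mutualInfo (fun z : ι' × κ' => p (e z.1, f z.2)) = mutualInfo p := by
  rw [mutualInfo_eq, mutualInfo_eq, ← e.sum_comp]
  refine congrArg (· / _) (sum_congr rfl fun x _ => ?_)
  rw [← f.sum_comp]
  refine sum_congr rfl fun y _ => ?_
  rw [← f.sum_comp (fun y' => p (e x, y')), ← e.sum_comp (fun x' => p (x', f y))]

/-- This is `log x ≤ x - 1` at `x = b / a`. As `Real.log 0 = 0`, the case `b = 0 < a`, where the
left side should be `-∞`, has to be excluded. -/
theorem mul_log_sub_log_le {a b : ℝ} (ha : 0 ≤ a) (hb : 0 ≤ b) (hab : b = 0 → a = 0) :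
    a * (Real.log b - Real.log a) ≤ b - a := by
  rcases ha.eq_or_lt with rfl | ha'
  · simpa using hb
  have hb' : 0 < b := hb.lt_of_ne fun h => ha'.ne' (hab h.symm)
  rw [← Real.log_div hb'.ne' ha'.ne']
  calc a * Real.log (b / a) ≤ a * (b / a - 1) := by
        gcongr
        exact Real.log_le_sub_one_of_pos (by positivity)
    _ = b - a := by field_simp

/-- Gibbs' inequality. -/
theorem sum_mul_log_sub_log_nonpos {p r : ι → ℝ} (hp : ∀ x, 0 ≤ p x) (hr : ∀ x, 0 ≤ r x)
    (hpr : ∀ x, r x = 0 → p x = 0) (hle : ∑ x, r x ≤ ∑ x, p x) :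
    ∑ x, p x * (Real.log (r x) - Real.log (p x)) ≤ 0 := by
  calc ∑ x, p x * (Real.log (r x) - Real.log (p x)) ≤ ∑ x, (r x - p x) :=
        sum_le_sum fun x _ => mul_log_sub_log_le (hp x) (hr x) (hpr x)
    _ ≤ 0 := by rw [sum_sub_distrib]; linarith

/-- A joint distribution that is dominated by `C` times a product distribution has mutual
information at most `log C`. -/
theorem mutualInfo_le_logb {p : ι × κ → ℝ} {r : ι → ℝ} {s : κ → ℝ} {C : ℝ} (hC : 0 < C)
    (hp : ∀ z, 0 ≤ p z) (hp1 : ∑ z, p z = 1) (hr : ∀ x, 0 ≤ r x) (hs : ∀ y, 0 ≤ s y)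
    (hr1 : ∑ x, r x ≤ 1) (hs1 : ∑ y, s y ≤ 1) (hle : ∀ x y, p (x, y) ≤ C * r x * s y) :
    mutualInfo p ≤ Real.logb 2 C := by
  have hpA : ∀ x, 0 ≤ ∑ y, p (x, y) := fun x => sum_nonneg fun y _ => hp _
  have hpB : ∀ y, 0 ≤ ∑ x, p (x, y) := fun y => sum_nonneg fun x _ => hp _
  have hA := sum_mul_log_sub_log_nonpos (p := fun x => ∑ y, p (x, y)) (r := r) hpA hr
    (fun x hx => sum_eq_zero fun y _ => le_antisymm (by simpa [hx] using hle x y) (hp _))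
    (by rw [← Fintype.sum_prod_type, hp1]; exact hr1)
  have hB := sum_mul_log_sub_log_nonpos (p := fun y => ∑ x, p (x, y)) (r := s) hpB hs
    (fun y hy => sum_eq_zero fun x _ => le_antisymm (by simpa [hy] using hle x y) (hp _))
    (by rw [← Fintype.sum_prod_type_right, hp1]; exact hs1)
  simp only [sum_mul] at hA hB
  rw [sum_comm] at hB
  rw [mutualInfo_eq, Real.logb]
  refine div_le_div_of_nonneg_right ?_ (Real.log_nonneg one_le_two)
  -- Pointwise, `log p ≤ log C + log r + log s`. Summed, the last two terms are minus the relative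
  -- entropies of the marginals to `r` and `s`, hence at most zero.
  have key : ∀ x y, p (x, y) * (Real.log (p (x, y)) - Real.log (∑ y', p (x, y')) -
      Real.log (∑ x', p (x', y))) ≤ p (x, y) * Real.log C +
      p (x, y) * (Real.log (r x) - Real.log (∑ y', p (x, y'))) +
      p (x, y) * (Real.log (s y) - Real.log (∑ x', p (x', y))) := by
    intro x y
    rcases (hp (x, y)).eq_or_lt with h | h
    · simp [← h]
    have hxy := h.trans_le (hle x y)
    have hrx : 0 < r x := (hr x).lt_of_ne fun h' => by simp [← h'] at hxy
    have hsy : 0 < s y := (hs y).lt_of_ne fun h' => by simp [← h'] at hxy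
    have hlog := Real.log_le_log h (hle x y)
    rw [Real.log_mul (by positivity) hsy.ne', Real.log_mul hC.ne' hrx.ne'] at hlog
    rw [← mul_add, ← mul_add]
    refine mul_le_mul_of_nonneg_left ?_ h.le
    linarith
  have hsum := sum_le_sum fun x (_ : x ∈ univ) => sum_le_sum fun y (_ : y ∈ univ) => key x y
  simp only [sum_add_distrib, ← sum_mul] at hsum hA hB
  rw [← Fintype.sum_prod_type, hp1, one_mul] at hsum
  linarith

/-- The log sum inequality. -/
theorem log_sum_inequality (v n : κ → ℝ) (hv : ∀ j, 0 ≤ v j) (hn : ∀ j, 0 ≤ n j) :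
    (∑ j, v j * n j) * (Real.log (∑ j, v j * n j) - Real.log (∑ j, v j)) ≤
      ∑ j, v j * (n j * Real.log (n j)) := by
  have hP : 0 ≤ ∑ j, v j * n j := sum_nonneg fun j _ => mul_nonneg (hv j) (hn j)
  rcases hP.eq_or_lt with h0 | h0
  · have h : ∀ j, v j * n j = 0 := fun j =>
      (sum_eq_zero_iff_of_nonneg fun j _ => mul_nonneg (hv j) (hn j)).1 h0.symm j (mem_univ j)
    simp [← mul_assoc, h]
  have hQ : 0 < ∑ j, v j := by
    refine (sum_nonneg fun j _ => hv j).lt_of_ne fun h => h0.ne' ?_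
    have h' := (sum_eq_zero_iff_of_nonneg fun j _ => hv j).1 h.symm
    exact sum_eq_zero fun j hj => by rw [h' j hj, zero_mul]
  set P := ∑ j, v j * n j
  set Q := ∑ j, v j
  -- The tangent-line bound at the weighted mean `P / Q`. Its linear terms cancel in the sum,
  -- because `Q * (P / Q) = P`.
  have key : ∀ j, v j * n j * (Real.log P - Real.log Q) - v j * (P / Q) + v j * n j ≤
      v j * (n j * Real.log (n j)) := by
    intro j
    have := mul_le_mul_of_nonneg_left (mul_log_sub_log_le (hn j) (div_pos h0 hQ).le
      fun h => absurd h (div_pos h0 hQ).ne') (hv j)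
    rw [Real.log_div h0.ne' hQ.ne'] at this
    linarith
  have hsum := sum_le_sum fun j (_ : j ∈ univ) => key j
  rw [sum_add_distrib, sum_sub_distrib, ← sum_mul, ← sum_mul] at hsum
  have : Q * (P / Q) = P := by field_simp
  change P * _ - Q * (P / Q) + P ≤ _ at hsum
  linarith

/-- Data processing: if `x` is obtained from a uniformly distributed `j` by a channel `w`, and `y`
is obtained from `j` with probability `n j y`, then `I(x : y) ≤ I(j : y)`. -/
theorem mutualInfo_le_of_channel {μ : Type} [Fintype μ] (c : ℝ) (hc : 0 ≤ c) (w : μ → ι → ℝ)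
    (n : μ → κ → ℝ) (hw : ∀ j x, 0 ≤ w j x) (hw1 : ∀ j, ∑ x, w j x = 1)
    (hn : ∀ j y, 0 ≤ n j y) (hn1 : ∀ j, ∑ y, n j y = 1) :
    mutualInfo (fun z : ι × κ => ∑ j, c * w j z.1 * n j z.2) ≤
      (∑ y, ∑ j, c * (n j y * (Real.log (n j y) - Real.log (∑ i, c * n i y)))) / Real.log 2 := by
  rw [mutualInfo_eq]
  refine div_le_div_of_nonneg_right ?_ (Real.log_nonneg one_le_two)
  have hA : ∀ x, ∑ y, ∑ j, c * w j x * n j y = ∑ j, c * w j x := fun x => by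
    rw [sum_comm]
    exact sum_congr rfl fun j _ => by rw [← mul_sum, hn1, mul_one]
  have hB : ∀ y, ∑ x, ∑ j, c * w j x * n j y = ∑ j, c * n j y := fun y => by
    rw [sum_comm]
    exact sum_congr rfl fun j _ => by rw [← sum_mul, ← mul_sum, hw1, mul_one]
  simp only [hA, hB]
  rw [sum_comm]
  refine sum_le_sum fun y _ => ?_
  -- For fixed `y`, merging the indices `j` into `x` can only lose information. The marginal of `y`
  -- is the same on both sides, so its term is carried along linearly.
  have hls := fun x => log_sum_inequality (fun j => c * w j x) (fun j => n j y)
    (fun j => mul_nonneg hc (hw j x)) (fun j => hn j y)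
  have hsum := sum_le_sum fun x (_ : x ∈ univ) => hls x
  have e1 : ∑ x, ∑ j, c * w j x * (n j y * Real.log (n j y)) =
      ∑ j, c * (n j y * Real.log (n j y)) := by
    rw [sum_comm]
    exact sum_congr rfl fun j _ => by rw [← sum_mul, ← mul_sum, hw1, mul_one]
  have e2 : ∑ x, (∑ j, c * w j x * n j y) * Real.log (∑ i, c * n i y) =
      ∑ j, c * (n j y * Real.log (∑ i, c * n i y)) := by
    rw [← sum_mul, hB, sum_mul]
    exact sum_congr rfl fun j _ => by ring
  rw [e1] at hsum
  simp only [mul_sub, sum_sub_distrib] at hsum ⊢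
  rw [e2]
  linarith

end MutualInformation

/-! ### The Maassen–Uffink relation by complex interpolation -/

section UncertaintyRelation

/-- The derivative at the left edge of Hadamard's three lines theorem, for exponential sums. -/
theorem re_sum_mul_le_of_norm_exp_sum_le {S : Type} [Fintype S] (c : S → ℂ) (r : S → ℝ)
    {T K : ℝ} (hT : 0 < T) (hK : 0 < K) (hc : ∑ s, c s = T)
    (h0 : ∀ z : ℂ, z.re = 0 → ‖∑ s, c s * Complex.exp (z * r s)‖ ≤ T)
    (h1 : ∀ z : ℂ, z.re = 1 → ‖∑ s, c s * Complex.exp (z * r s)‖ ≤ K) :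
    (∑ s, c s * r s).re ≤ T * (Real.log K - Real.log T) := by
  set F : ℂ → ℂ := fun z => ∑ s, c s * Complex.exp (z * r s) with hF
  have hdiff : Differentiable ℂ F := by fun_prop
  have hbdd : BddAbove ((norm ∘ F) '' Complex.HadamardThreeLines.verticalClosedStrip 0 1) := by
    refine ⟨∑ s, ‖c s‖ * Real.exp |r s|, ?_⟩
    rintro _ ⟨z, hz, rfl⟩
    have hz' : 0 ≤ z.re ∧ z.re ≤ 1 := hz
    refine (norm_sum_le _ _).trans (sum_le_sum fun s _ => ?_)
    rw [norm_mul, Complex.norm_exp]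
    gcongr
    rw [Complex.re_mul_ofReal]
    calc z.re * r s ≤ z.re * |r s| := mul_le_mul_of_nonneg_left (le_abs_self _) hz'.1
      _ ≤ 1 * |r s| := mul_le_mul_of_nonneg_right hz'.2 (abs_nonneg _)
      _ = |r s| := one_mul _
  -- The interpolated bound `T ^ (1 - x) * K ^ x`, in a form that is easy to differentiate.
  have hline : ∀ x : ℝ, 0 ≤ x → x ≤ 1 →
      (F x).re ≤ Real.exp (Real.log T * (1 - x) + Real.log K * x) := by
    intro x hx0 hx1
    have := Complex.HadamardThreeLines.norm_le_interp_of_mem_verticalClosedStrip₀₁' F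
      (z := (x : ℂ)) (a := T) (b := K) ⟨by simpa using hx0, by simpa using hx1⟩
      hdiff.diffContOnCl hbdd (fun z hz => h0 z hz) (fun z hz => h1 z hz)
    rw [Complex.ofReal_re, Real.rpow_def_of_pos hT, Real.rpow_def_of_pos hK, ← Real.exp_add] at this
    exact (Complex.re_le_norm _).trans this
  have hFder : HasDerivAt F (∑ s, c s * r s) ((0 : ℝ) : ℂ) := by
    refine HasDerivAt.fun_sum fun s _ => ?_
    have := ((hasDerivAt_mul_const (x := ((0 : ℝ) : ℂ)) (r s : ℂ)).cexp).const_mul (c s)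
    simpa using this
  have hgder : HasDerivAt (fun x : ℝ => Real.exp (Real.log T * (1 - x) + Real.log K * x))
      (T * (Real.log K - Real.log T)) 0 := by
    have h : HasDerivAt (fun x : ℝ => Real.log T * (1 - x) + Real.log K * x)
        (Real.log T * -1 + Real.log K * 1) 0 :=
      (((hasDerivAt_id (0 : ℝ)).const_sub 1).const_mul _).add ((hasDerivAt_id (0 : ℝ)).const_mul _)
    convert h.exp using 1
    simp only [sub_zero, mul_one, mul_zero, add_zero, Real.exp_log hT]
    ring
  -- Both sides of `hline` equal `T` at `x = 0`, so the inequality passes to their right derivatives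
  -- there.
  have hder := (hgder.sub hFder.real_of_complex).tendsto_slope_zero_right
  refine sub_nonneg.1 (ge_of_tendsto hder ?_)
  filter_upwards [Ioc_mem_nhdsGT (zero_lt_one (α := ℝ))] with x hx
  refine smul_nonneg (inv_nonneg.2 hx.1.le) ?_
  have hx' := hline x hx.1.le hx.2
  have hF0 : (F ((0 : ℝ) : ℂ)).re = T := by simp [hF, hc]
  simp only [Pi.sub_apply, zero_add, hF0, sub_zero, mul_one, mul_zero, add_zero, Real.exp_log hT]
  linarith

variable {l n : Type} [Fintype l] [Fintype n]

theorem sum_norm_sq_eq_trace_re (A : Matrix l n ℂ) :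
    ∑ x, ∑ i, ‖A x i‖ ^ 2 = (A * A.conjTranspose).trace.re := by
  simp only [Matrix.trace, Matrix.diag_apply, Matrix.mul_apply, Matrix.conjTranspose_apply,
    Complex.re_sum]
  refine sum_congr rfl fun x _ => sum_congr rfl fun i _ => ?_
  rw [RCLike.star_def, Complex.mul_conj, Complex.normSq_eq_norm_sq, Complex.ofReal_re]

theorem sum_norm_sq_mul_unitary [DecidableEq n] (A : Matrix l n ℂ) {V : Matrix n n ℂ}
    (hV : V ∈ Matrix.unitaryGroup n ℂ) :
    ∑ x, ∑ i, ‖(A * V) x i‖ ^ 2 = ∑ x, ∑ i, ‖A x i‖ ^ 2 := by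
  have h : V * V.conjTranspose = 1 := Matrix.mem_unitaryGroup_iff.1 hV
  rw [sum_norm_sq_eq_trace_re, sum_norm_sq_eq_trace_re, Matrix.conjTranspose_mul,
    Matrix.mul_assoc, ← Matrix.mul_assoc V, h, Matrix.one_mul]

theorem norm_sum_mul_le_of_sum_norm_sq_le (X Y : Matrix l n ℂ) {T : ℝ}
    (hX : ∑ x, ∑ i, ‖X x i‖ ^ 2 ≤ T) (hY : ∑ x, ∑ i, ‖Y x i‖ ^ 2 ≤ T) :
    ‖∑ x, ∑ i, X x i * Y x i‖ ≤ T := by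
  have key : ∀ x i, ‖X x i * Y x i‖ ≤ (‖X x i‖ ^ 2 + ‖Y x i‖ ^ 2) / 2 := fun x i => by
    rw [norm_mul]
    nlinarith [sq_nonneg (‖X x i‖ - ‖Y x i‖)]
  calc ‖∑ x, ∑ i, X x i * Y x i‖ ≤ ∑ x, ∑ i, (‖X x i‖ ^ 2 + ‖Y x i‖ ^ 2) / 2 :=
        norm_sum_le_of_le _ fun x _ => norm_sum_le_of_le _ fun i _ => key x i
    _ = (∑ x, ∑ i, ‖X x i‖ ^ 2 + ∑ x, ∑ i, ‖Y x i‖ ^ 2) / 2 := by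
        simp only [← sum_div, sum_add_distrib]
    _ ≤ T := by linarith

/-- At `p = 0` the exponential is `1` rather than `√p`, as `Real.log 0 = 0`; the factor `√p` makes
the identity hold there too. -/
theorem exp_half_log_mul_sqrt {p : ℝ} (hp : 0 ≤ p) : Real.exp (Real.log p / 2) * √p = p := by
  rcases hp.eq_or_lt with rfl | hp'
  · simp
  · rw [← Real.log_sqrt hp, Real.exp_log (Real.sqrt_pos.2 hp'), Real.mul_self_sqrt hp]

/-- The Maassen–Uffink uncertainty relation, for the positive semidefinite matrix `Bᴴ * B` of
trace `T`, the computational basis and the basis of the columns of `V`. -/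
theorem sum_mul_log_add_sum_mul_log_le [DecidableEq n] (B : Matrix l n ℂ) {V : Matrix n n ℂ}
    (hV : V ∈ Matrix.unitaryGroup n ℂ) {c T : ℝ} (hc : 0 < c) (hVc : ∀ i k, ‖V i k‖ ≤ c)
    {p q : n → ℝ} (hp : ∀ i, ∑ x, ‖B x i‖ ^ 2 = p i) (hq : ∀ k, ∑ x, ‖(B * V) x k‖ ^ 2 = q k)
    (hT : ∑ i, p i = T) :
    ∑ i, p i * Real.log (p i) + ∑ k, q k * Real.log (q k) ≤
      2 * T * (Real.log c + Real.log T) := by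
  have hVV : V * V.conjTranspose = 1 := Matrix.mem_unitaryGroup_iff.1 hV
  have hp0 : ∀ i, 0 ≤ p i := fun i => hp i ▸ sum_nonneg fun x _ => sq_nonneg _
  have hq0 : ∀ k, 0 ≤ q k := fun k => hq k ▸ sum_nonneg fun x _ => sq_nonneg _
  have hBT : ∑ x, ∑ i, ‖B x i‖ ^ 2 = T := by
    rw [sum_comm, ← hT]
    exact sum_congr rfl fun i _ => hp i
  have hCT : ∑ x, ∑ k, ‖(B * V) x k‖ ^ 2 = T := by rw [sum_norm_sq_mul_unitary B hV, hBT]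
  have hqT : ∑ k, q k = T := by
    rw [← hCT, sum_comm]
    exact sum_congr rfl fun k _ => (hq k).symm
  have hT0 : 0 ≤ T := hT ▸ sum_nonneg fun i _ => hp0 i
  rcases hT0.eq_or_lt with h0 | hTpos
  · have hpz : ∀ i, p i = 0 := fun i =>
      (sum_eq_zero_iff_of_nonneg fun i _ => hp0 i).1 (hT.trans h0.symm) i (mem_univ i)
    have hqz : ∀ k, q k = 0 := fun k =>
      (sum_eq_zero_iff_of_nonneg fun k _ => hq0 k).1 (hqT.trans h0.symm) k (mem_univ k)
    simp [hpz, hqz, ← h0]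
  have hsum_i : ∀ x k, ∑ i, star (V i k) * star (B x i) = star ((B * V) x k) := fun x k => by
    rw [Matrix.mul_apply, star_sum]
    exact sum_congr rfl fun i _ => by rw [star_mul]
  have hsum_k : ∀ x i, ∑ k, star (V i k) * (B * V) x k = B x i := fun x i => by
    have : B * V * V.conjTranspose = B := by rw [Matrix.mul_assoc, hVV, Matrix.mul_one]
    conv_rhs => rw [← this, Matrix.mul_apply]
    exact sum_congr rfl fun k _ => by rw [Matrix.conjTranspose_apply, mul_comm]
  have hsq : ∀ z : ℂ, star z * z = ((‖z‖ ^ 2 : ℝ) : ℂ) := fun z => by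
    rw [RCLike.star_def, mul_comm, Complex.mul_conj, Complex.normSq_eq_norm_sq]
  -- The interpolating function is the sum of `conj V_ik * conj B_xi * (BV)_xk * (p_i q_k) ^ (z /
  -- 2)`. Its value at `0` is `T`, and its derivative there is half the left side of the claim. With
  -- `K = c T²`, the bound becomes `T (log c + log T)`.
  have key := re_sum_mul_le_of_norm_exp_sum_le (S := l × n × n)
    (fun s => star (V s.2.1 s.2.2) * star (B s.1 s.2.1) * (B * V) s.1 s.2.2)
    (fun s => Real.log (p s.2.1) / 2 + Real.log (q s.2.2) / 2) (T := T) (K := c * T ^ 2)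
    hTpos (by positivity) ?_ ?_ ?_
  · have hlin : ∑ s : l × n × n, star (V s.2.1 s.2.2) * star (B s.1 s.2.1) * (B * V) s.1 s.2.2 *
        ((Real.log (p s.2.1) / 2 + Real.log (q s.2.2) / 2 : ℝ) : ℂ) =
        ((∑ i, p i * (Real.log (p i) / 2) + ∑ k, q k * (Real.log (q k) / 2) : ℝ) : ℂ) := by
      simp only [Fintype.sum_prod_type, Complex.ofReal_add, mul_add, sum_add_distrib]
      rw [Complex.ofReal_sum, Complex.ofReal_sum]
      congr 1
      · rw [sum_comm]
        refine sum_congr rfl fun i _ => ?_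
        rw [Complex.ofReal_mul, ← hp i, Complex.ofReal_sum, sum_mul]
        refine sum_congr rfl fun x _ => ?_
        rw [← sum_mul, ← hsq]
        congr 1
        rw [← hsum_k x i, mul_sum, hsum_k]
        exact sum_congr rfl fun k _ => by ring
      · rw [sum_congr rfl fun x _ => sum_comm, sum_comm]
        refine sum_congr rfl fun k _ => ?_
        rw [Complex.ofReal_mul, ← hq k, Complex.ofReal_sum, sum_mul]
        refine sum_congr rfl fun x _ => ?_
        rw [← sum_mul, ← sum_mul, hsum_i, hsq]
    rw [hlin, Complex.ofReal_re, Real.log_mul hc.ne' (by positivity), Real.log_pow] at key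
    simp only [mul_div_assoc', ← sum_div] at key
    push_cast at key
    linarith
  · rw [← hCT, Complex.ofReal_sum]
    simp only [Fintype.sum_prod_type]
    refine sum_congr rfl fun x _ => ?_
    rw [sum_comm, Complex.ofReal_sum]
    exact sum_congr rfl fun k _ => by rw [← sum_mul, hsum_i, hsq]
  · intro z hz
    set u : n → ℂ := fun i => Complex.exp (z * (Real.log (p i) / 2 : ℝ)) with hu
    set v : n → ℂ := fun k => Complex.exp (z * (Real.log (q k) / 2 : ℝ)) with hv
    have hu1 : ∀ i, ‖u i‖ = 1 := fun i => by
      rw [hu, Complex.norm_exp, Complex.re_mul_ofReal, hz, zero_mul, Real.exp_zero]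
    have hv1 : ∀ k, ‖v k‖ = 1 := fun k => by
      rw [hv, Complex.norm_exp, Complex.re_mul_ofReal, hz, zero_mul, Real.exp_zero]
    -- On `Re z = 0` the weights `u` and `v` are phases, so neither they nor `V` change the sum of
    -- squared norms.
    have hX : ∑ x, ∑ k, ‖(Matrix.of fun x k => star (v k * (B * V) x k)) x k‖ ^ 2 ≤ T := by
      simp only [Matrix.of_apply, norm_star, norm_mul, hv1, one_mul]
      exact hCT.le
    have hY : ∑ x, ∑ k, ‖((Matrix.of fun x i => star (u i) * B x i) * V) x k‖ ^ 2 ≤ T := by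
      rw [sum_norm_sq_mul_unitary _ hV]
      simp only [Matrix.of_apply, norm_star, norm_mul, hu1, one_mul]
      exact hBT.le
    have hXY := norm_sum_mul_le_of_sum_norm_sq_le _ _ hX hY
    rw [← norm_star] at hXY
    refine le_of_eq_of_le (congrArg _ ?_) hXY
    simp only [Fintype.sum_prod_type, star_sum, star_mul', Matrix.of_apply, star_star,
      Matrix.mul_apply]
    refine sum_congr rfl fun x _ => ?_
    rw [sum_comm]
    refine sum_congr rfl fun k _ => ?_
    simp only [Complex.ofReal_add, mul_add, Complex.exp_add]
    rw [mul_sum]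
    refine sum_congr rfl fun i _ => ?_
    simp only [hu, hv]
    ring
  · intro z hz
    -- On `Re z = 1` each entry of `V` costs `c`, and Cauchy–Schwarz over `x` supplies the square
    -- roots that complete the weights to `p i * q k`.
    have hcs : ∀ i k, ∑ x, ‖B x i‖ * ‖(B * V) x k‖ ≤ √(p i) * √(q k) := fun i k => by
      rw [← hp, ← hq]
      exact Real.sum_mul_le_sqrt_mul_sqrt _ _ _
    calc ‖∑ s : l × n × n, star (V s.2.1 s.2.2) * star (B s.1 s.2.1) * (B * V) s.1 s.2.2 *
          Complex.exp (z * (Real.log (p s.2.1) / 2 + Real.log (q s.2.2) / 2 : ℝ))‖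
        ≤ ∑ s : l × n × n, c * ‖B s.1 s.2.1‖ * ‖(B * V) s.1 s.2.2‖ *
          (Real.exp (Real.log (p s.2.1) / 2) * Real.exp (Real.log (q s.2.2) / 2)) := by
          refine norm_sum_le_of_le _ fun s _ => ?_
          rw [norm_mul, norm_mul, norm_mul, norm_star, norm_star, Complex.norm_exp,
            Complex.re_mul_ofReal, hz, one_mul, Real.exp_add]
          gcongr
          exact hVc _ _
      _ = ∑ i, ∑ k, c * (Real.exp (Real.log (p i) / 2) * Real.exp (Real.log (q k) / 2)) *
          ∑ x, ‖B x i‖ * ‖(B * V) x k‖ := by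
          rw [Fintype.sum_prod_type, sum_comm, Fintype.sum_prod_type]
          refine sum_congr rfl fun i _ => sum_congr rfl fun k _ => ?_
          rw [mul_sum]
          exact sum_congr rfl fun x _ => by ring
      _ ≤ ∑ i, ∑ k, c * (Real.exp (Real.log (p i) / 2) * Real.exp (Real.log (q k) / 2)) *
          (√(p i) * √(q k)) := by
          gcongr
          exact hcs _ _
      _ = ∑ i, ∑ k, c * (p i * q k) := by
          refine sum_congr rfl fun i _ => sum_congr rfl fun k _ => ?_
          conv_rhs => rw [← exp_half_log_mul_sqrt (hp0 i), ← exp_half_log_mul_sqrt (hq0 k)]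
          ring
      _ = c * T ^ 2 := by
          simp only [← mul_sum, hqT, ← sum_mul, hT]
          ring

end UncertaintyRelation

/-! ### Upper bound for one bit of communication -/

section OneBitBound

theorem posSemidef_exists_eq {n : Type} [Fintype n] {A : Matrix n n ℂ} (hA : A.PosSemidef) :
    ∃ B : Matrix n n ℂ, A = B.conjTranspose * B := by
  classical
  open scoped MatrixOrder in
  exact CStarAlgebra.nonneg_iff_eq_star_mul_self.1 hA.nonneg

theorem trace_mul_nonneg {n : Type} [Fintype n] {A B : Matrix n n ℂ} (hA : A.PosSemidef)
    (hB : B.PosSemidef) : 0 ≤ (A * B).trace := by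
  obtain ⟨C, rfl⟩ := posSemidef_exists_eq hA
  rw [Matrix.mul_assoc, Matrix.trace_mul_comm]
  exact (hB.mul_mul_conjTranspose_same C).trace_nonneg

/-- With `A = Bᴴ * B` this says that the Frobenius norm of `B` bounds its operator norm, which is
Cauchy–Schwarz on each row. -/
theorem posSemidef_trace_smul_one_sub {n : Type} [Fintype n] [DecidableEq n] {A : Matrix n n ℂ}
    (hA : A.PosSemidef) : (A.trace • (1 : Matrix n n ℂ) - A).PosSemidef := by
  have htr : star A.trace = A.trace := by
    rw [← Matrix.trace_conjTranspose, hA.isHermitian.eq]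
  refine Matrix.PosSemidef.of_dotProduct_mulVec_nonneg ?_ fun v => ?_
  · rw [Matrix.IsHermitian, Matrix.conjTranspose_sub, Matrix.conjTranspose_smul, htr,
      Matrix.conjTranspose_one, hA.isHermitian.eq]
  obtain ⟨B, rfl⟩ := posSemidef_exists_eq hA
  have e1 : (B.conjTranspose * B).trace = ((∑ x, ∑ i, ‖B x i‖ ^ 2 : ℝ) : ℂ) := by
    rw [sum_comm]
    simp [Matrix.trace, Matrix.mul_apply, ← Complex.mul_conj', mul_comm]
  have e2 : star v ⬝ᵥ v = ((∑ i, ‖v i‖ ^ 2 : ℝ) : ℂ) := by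
    simp [dotProduct, ← Complex.mul_conj', mul_comm]
  have e3 : star v ⬝ᵥ ((B.conjTranspose * B).mulVec v) =
      ((∑ x, ‖B.mulVec v x‖ ^ 2 : ℝ) : ℂ) := by
    rw [← Matrix.mulVec_mulVec, Matrix.dotProduct_mulVec, ← Matrix.star_mulVec]
    simp [dotProduct, ← Complex.mul_conj', mul_comm]
  rw [Matrix.sub_mulVec, dotProduct_sub, Matrix.smul_mulVec, Matrix.one_mulVec,
    dotProduct_smul, e3, e2, e1, smul_eq_mul, ← Complex.ofReal_mul, ← Complex.ofReal_sub,
    Complex.zero_le_real, sub_nonneg, sum_mul]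
  refine sum_le_sum fun x _ => ?_
  calc ‖B.mulVec v x‖ ^ 2 ≤ (∑ i, ‖B x i‖ * ‖v i‖) ^ 2 := by
        gcongr
        exact norm_sum_le_of_le _ fun i _ => (norm_mul _ _).le
    _ ≤ _ := sum_mul_sq_le_sq_mul_sq _ _ _

variable {a b : Type} [Fintype a] [Fintype b]

theorem trace_kronecker_mul_re_nonneg {ρ : Matrix (a × b) (a × b) ℂ} (hρ : ρ.PosSemidef)
    {E : Matrix a a ℂ} {F : Matrix b b ℂ} (hE : E.PosSemidef) (hF : F.PosSemidef) :
    0 ≤ ((E ⊗ₖ F) * ρ).trace.re :=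
  (Complex.nonneg_iff.1 (trace_mul_nonneg (hE.kronecker hF) hρ)).1

theorem trace_kronecker_mul_re_le [DecidableEq b] {ρ : Matrix (a × b) (a × b) ℂ} (hρ : ρ.PosSemidef)
    {E : Matrix a a ℂ} {F : Matrix b b ℂ} (hE : E.PosSemidef) (hF : F.PosSemidef) :
    ((E ⊗ₖ F) * ρ).trace.re ≤ ((E ⊗ₖ (1 : Matrix b b ℂ)) * ρ).trace.re * F.trace.re := by
  have h := trace_kronecker_mul_re_nonneg hρ hE (posSemidef_trace_smul_one_sub hF)
  have hF0 : F.trace.im = 0 := (Complex.nonneg_iff.1 hF.trace_nonneg).2.symm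
  rw [sub_eq_add_neg, Matrix.kronecker_add, Matrix.kronecker_smul, ← neg_one_smul ℂ F,
    Matrix.kronecker_smul, Matrix.add_mul, Matrix.smul_mul, Matrix.smul_mul, Matrix.trace_add,
    Matrix.trace_smul, Matrix.trace_smul] at h
  simp [hF0] at h
  linarith

/-- Outcomes of local measurements that share a bit `m`, with effects `E m x` and `F m y`. -/
theorem mutualInfo_le_of_shared_bit [DecidableEq a] [DecidableEq b]
    {ρ : Matrix (a × b) (a × b) ℂ} (hρ : ρ.PosSemidef)
    (hρ1 : ρ.trace = 1) {ι κ : Type} [Fintype ι] [Fintype κ] {E : Fin 2 → ι → Matrix a a ℂ}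
    {F : Fin 2 → κ → Matrix b b ℂ} (hE : ∀ m x, (E m x).PosSemidef)
    (hF : ∀ m y, (F m y).PosSemidef) {R S : ℕ} (hR : 0 < R) (hS : 0 < S)
    (hER : ∑ m, ∑ x, E m x = (R : ℂ) • (1 : Matrix a a ℂ))
    (hFS : ∑ m, ∑ y, F m y = (S : ℂ) • (1 : Matrix b b ℂ))
    (hEF : ∑ m, (∑ x, E m x) ⊗ₖ (∑ y, F m y) = 1) :
    mutualInfo (fun z : ι × κ => ∑ m, ((E m z.1 ⊗ₖ F m z.2) * ρ).trace.re) ≤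
      Real.logb 2 (R * S * Fintype.card b) := by
  have hb : 0 < Fintype.card b := by
    rw [Fintype.card_pos_iff]
    by_contra h
    rw [not_nonempty_iff] at h
    simp [Matrix.trace] at hρ1
  have hR' : (0 : ℝ) < R := by exact_mod_cast hR
  have hS' : (0 : ℝ) < S := by exact_mod_cast hS
  have hb' : (0 : ℝ) < Fintype.card b := by exact_mod_cast hb
  have hp : ∀ m x y, 0 ≤ ((E m x ⊗ₖ F m y) * ρ).trace.re := fun m x y =>
    trace_kronecker_mul_re_nonneg hρ (hE m x) (hF m y)
  have he : ∀ m x, 0 ≤ ((E m x ⊗ₖ (1 : Matrix b b ℂ)) * ρ).trace.re := fun m x =>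
    trace_kronecker_mul_re_nonneg hρ (hE m x) Matrix.PosSemidef.one
  have hf : ∀ m y, 0 ≤ (F m y).trace.re := fun m y =>
    (Complex.nonneg_iff.1 (hF m y).trace_nonneg).1
  have hkr : ∀ m, (∑ x, E m x) ⊗ₖ (∑ y, F m y) = ∑ x, ∑ y, E m x ⊗ₖ F m y := fun m => by
    ext ⟨i, i'⟩ ⟨j, j'⟩
    simp only [Matrix.kronecker_apply, Matrix.sum_apply, sum_mul_sum]
  have hkr1 : ∀ G : Fin 2 → ι → Matrix a a ℂ,
      (∑ m, ∑ x, G m x) ⊗ₖ (1 : Matrix b b ℂ) = ∑ m, ∑ x, G m x ⊗ₖ (1 : Matrix b b ℂ) := fun G => by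
    ext ⟨i, i'⟩ ⟨j, j'⟩
    simp only [Matrix.kronecker_apply, Matrix.sum_apply, sum_mul]
  -- The dominating product: Alice's outcome weights, normalised by `R`, and the traces of Bob's
  -- effects, whose total is `S` times the dimension of `b`.
  refine mutualInfo_le_logb (r := fun x => (∑ m, ((E m x ⊗ₖ (1 : Matrix b b ℂ)) * ρ).trace.re) / R)
    (s := fun y => (∑ m, (F m y).trace.re) / (S * Fintype.card b)) (by positivity)
    (fun z => sum_nonneg fun m _ => hp m _ _) ?_
    (fun x => div_nonneg (sum_nonneg fun m _ => he m x) hR'.le)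
    (fun y => div_nonneg (sum_nonneg fun m _ => hf m y) (by positivity)) ?_ ?_ fun x y => ?_
  · have h := congrArg (fun X => (X * ρ).trace.re) hEF
    simp only [hkr, Matrix.one_mul, hρ1, Complex.one_re, Matrix.sum_mul, Matrix.trace_sum,
      Complex.re_sum] at h
    rw [sum_comm, ← h]
    simp only [Fintype.sum_prod_type]
  · have h := congrArg (fun X => ((X ⊗ₖ (1 : Matrix b b ℂ)) * ρ).trace.re) hER
    simp only [hkr1, Matrix.smul_kronecker, Matrix.one_kronecker_one, Matrix.smul_mul,
      Matrix.one_mul, Matrix.trace_smul, hρ1, Matrix.sum_mul, Matrix.trace_sum,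
      Complex.re_sum, smul_eq_mul, mul_one, Complex.natCast_re] at h
    rw [← sum_div, sum_comm, h, div_self hR'.ne']
  · have h := congrArg (fun X => X.trace.re) hFS
    simp only [Matrix.trace_smul, Matrix.trace_sum, Matrix.trace_one, Complex.re_sum, smul_eq_mul,
      ← Nat.cast_mul, Complex.natCast_re] at h
    rw [← sum_div, sum_comm, h, Nat.cast_mul, div_self (by positivity)]
  · calc ∑ m, ((E m x ⊗ₖ F m y) * ρ).trace.re
        ≤ ∑ m, ((E m x ⊗ₖ (1 : Matrix b b ℂ)) * ρ).trace.re * (F m y).trace.re :=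
          sum_le_sum fun m _ => trace_kronecker_mul_re_le hρ (hE m x) (hF m y)
      -- The product of the sums only adds nonnegative cross terms; this removes the dependence on
      -- the shared bit.
      _ ≤ (∑ m, ((E m x ⊗ₖ (1 : Matrix b b ℂ)) * ρ).trace.re) * ∑ m, (F m y).trace.re := by
          rw [Fin.sum_univ_two, Fin.sum_univ_two, Fin.sum_univ_two]
          nlinarith [mul_nonneg (he 0 x) (hf 1 y), mul_nonneg (he 1 x) (hf 0 y)]
      _ = _ := by field_simp

/-- The effect of a measurement that is preceded by the operation with Kraus operators `K`. -/
def pullback {a a' r : Type} [Fintype a'] [Fintype r] (K : r → Matrix a' a ℂ)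
    (M : Matrix a' a' ℂ) : Matrix a a ℂ :=
  ∑ i, (K i).conjTranspose * M * K i

theorem posSemidef_pullback {a a' r : Type} [Fintype a] [Fintype a'] [Fintype r]
    (K : r → Matrix a' a ℂ) {M : Matrix a' a' ℂ} (hM : M.PosSemidef) : (pullback K M).PosSemidef :=
  Matrix.posSemidef_sum _ fun i _ => hM.conjTranspose_mul_mul_same (K i)

theorem sum_pullback_effect {a a' r : Type} [Fintype a'] [DecidableEq a'] [Fintype r]
    (K : r → Matrix a' a ℂ) {n : ℕ} (M : POVM a' n) :
    ∑ x, pullback K (M.effect x) = ∑ i, (K i).conjTranspose * K i := by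
  simp only [pullback]
  rw [sum_comm]
  refine sum_congr rfl fun i _ => ?_
  rw [← Matrix.sum_mul, ← Matrix.mul_sum, M.sum_eq_one, Matrix.mul_one]

/-- Cyclicity of the trace moves the Kraus operators onto the effects, so that a protocol followed
by measurements becomes a pair of bit-dependent effects on the original systems. -/
theorem trace_kronecker_mul_sum_kraus {a' b' r s : Type} [Fintype a'] [Fintype b'] [Fintype r]
    [Fintype s] (ρ : Matrix (a × b) (a × b) ℂ) (K : r → Matrix a' a ℂ) (L : s → Matrix b' b ℂ)
    (M : Matrix a' a' ℂ) (N : Matrix b' b' ℂ) :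
    ((M ⊗ₖ N) * ∑ i, ∑ j, (K i ⊗ₖ L j) * ρ * (K i ⊗ₖ L j).conjTranspose).trace =
      ((pullback K M ⊗ₖ pullback L N) * ρ).trace := by
  have hkr : pullback K M ⊗ₖ pullback L N =
      ∑ i, ∑ j, (K i ⊗ₖ L j).conjTranspose * (M ⊗ₖ N) * (K i ⊗ₖ L j) := by
    simp only [Matrix.conjTranspose_kronecker, ← Matrix.mul_kronecker_mul]
    ext ⟨i, i'⟩ ⟨j, j'⟩
    simp only [pullback, Matrix.kronecker_apply, Matrix.sum_apply, sum_mul_sum]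
  rw [hkr]
  simp only [Matrix.mul_sum, Matrix.sum_mul, Matrix.trace_sum]
  refine sum_congr rfl fun i _ => sum_congr rfl fun j _ => ?_
  rw [← Matrix.mul_assoc, Matrix.trace_mul_comm]
  simp only [Matrix.mul_assoc]

/-- With one bit of communication, measurements extract at most `log (dim b) + 1` bits. -/
theorem mutualInfo_outcomeDist_apply_le [DecidableEq a] [DecidableEq b]
    {ρ : Matrix (a × b) (a × b) ℂ} (hρ : ρ.PosSemidef)
    (hρ1 : ρ.trace = 1) {a' b' : Type} [Fintype a'] [DecidableEq a'] [Fintype b'] [DecidableEq b']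
    (P : OneBitProtocol a b a' b') {m n : ℕ} (M : POVM a' m) (N : POVM b' n) :
    mutualInfo (outcomeDist (P.apply ρ) M N) ≤ Real.logb 2 (2 * Fintype.card b) := by
  have two : ∑ _m : Fin 2, (1 : Matrix b b ℂ) = ((2 : ℕ) : ℂ) • (1 : Matrix b b ℂ) := by
    simp [two_smul]
  have two' : ∑ _m : Fin 2, (1 : Matrix a a ℂ) = ((2 : ℕ) : ℂ) • (1 : Matrix a a ℂ) := by
    simp [two_smul]
  cases P with
  | aliceToBob S R =>
    have hE := S.trace_preserving
    have hF := fun t => (R t).trace_preserving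
    -- The sender's effects sum to `1` over all `m` together, the receiver's to `1` for each `m`.
    -- Hence `R = 1` and `S = 2` here, and the reverse in the other direction.
    have h := mutualInfo_le_of_shared_bit hρ hρ1
      (E := fun t x => pullback (S.kraus t) (M.effect x))
      (F := fun t y => pullback (R t).kraus (N.effect y))
      (fun t x => posSemidef_pullback _ (M.posSemidef x))
      (fun t y => posSemidef_pullback _ (N.posSemidef y)) one_pos two_pos
      (by simp only [sum_pullback_effect, hE, Nat.cast_one, one_smul])
      (by simp only [sum_pullback_effect, hF, two])
      (by
        simp only [sum_pullback_effect, hF]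
        rw [← Matrix.one_kronecker_one, ← hE]
        ext ⟨i, i'⟩ ⟨j, j'⟩
        simp only [Matrix.kronecker_apply, Matrix.sum_apply, sum_mul])
    convert h using 2
    · ext z
      simp only [outcomeDist, OneBitProtocol.apply, ← trace_kronecker_mul_sum_kraus,
        Matrix.mul_sum, Matrix.trace_sum, Complex.re_sum]
    · simp
  | bobToAlice S R =>
    have hF := S.trace_preserving
    have hE := fun t => (R t).trace_preserving
    have h := mutualInfo_le_of_shared_bit hρ hρ1
      (E := fun t x => pullback (R t).kraus (M.effect x))
      (F := fun t y => pullback (S.kraus t) (N.effect y))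
      (fun t x => posSemidef_pullback _ (M.posSemidef x))
      (fun t y => posSemidef_pullback _ (N.posSemidef y)) two_pos one_pos
      (by simp only [sum_pullback_effect, hE, two'])
      (by simp only [sum_pullback_effect, hF, Nat.cast_one, one_smul])
      (by
        simp only [sum_pullback_effect, hE]
        rw [← Matrix.one_kronecker_one, ← hF]
        ext ⟨i, i'⟩ ⟨j, j'⟩
        simp only [Matrix.kronecker_apply, Matrix.sum_apply, mul_sum])
    convert h using 2
    · ext z
      simp only [outcomeDist, OneBitProtocol.apply]
      rw [sum_congr rfl fun t _ => sum_comm]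
      simp only [← trace_kronecker_mul_sum_kraus,
        Matrix.mul_sum, Matrix.trace_sum, Complex.re_sum]
    · simp

theorem mutualInfo_mem_localInfoValues [DecidableEq a] [DecidableEq b]
    (ρ : Matrix (a × b) (a × b) ℂ) {ι κ : Type} [Fintype ι]
    [Fintype κ] (E : ι → Matrix a a ℂ) (F : κ → Matrix b b ℂ) (hE : ∀ x, (E x).PosSemidef)
    (hF : ∀ y, (F y).PosSemidef) (hE1 : ∑ x, E x = 1) (hF1 : ∑ y, F y = 1) :
    mutualInfo (fun z : ι × κ => ((E z.1 ⊗ₖ F z.2) * ρ).trace.re) ∈ localInfoValues ρ := by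
  refine ⟨_, _,
    ⟨fun x => E ((Fintype.equivFin ι).symm x), fun x => hE _, by rw [Equiv.sum_comp, hE1]⟩,
    ⟨fun y => F ((Fintype.equivFin κ).symm y), fun y => hF _, by rw [Equiv.sum_comp, hF1]⟩, ?_⟩
  rw [← mutualInfo_comp_equiv (Fintype.equivFin ι).symm (Fintype.equivFin κ).symm]
  rfl

end OneBitBound

/-! ### The locked state: `I_c = ½ log d` -/

section LockedState

theorem posSemidef_single_one {n : Type} [Fintype n] [DecidableEq n] (i : n) :
    (Matrix.single i i (1 : ℂ)).PosSemidef := by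
  have := Matrix.posSemidef_conjTranspose_mul_self (Matrix.single i i (1 : ℂ))
  simpa using this

theorem sum_single_one {n : Type} [Fintype n] [DecidableEq n] :
    ∑ i : n, Matrix.single i i (1 : ℂ) = 1 := by
  ext i j
  simp [Matrix.sum_apply, Matrix.single_apply, Matrix.one_apply, ite_and]

theorem trace_mul_ketbra {d : ℕ} (N V : Matrix (Fin d) (Fin d) ℂ) (k : Fin d) :
    (N * (V * ketbra k * V.conjTranspose)).trace = (V.conjTranspose * N * V) k k := by
  rw [← Matrix.mul_assoc, Matrix.trace_mul_comm, ← Matrix.mul_assoc, ← Matrix.mul_assoc, ketbra,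
    Matrix.trace_mul_single]
  simp

variable {d : ℕ} {U : Fin 2 → Matrix (Fin d) (Fin d) ℂ}

theorem conjTranspose_mul_self_eq_one (hU : ∀ t, U t ∈ Matrix.unitaryGroup (Fin d) ℂ) (t : Fin 2) :
    (U t).conjTranspose * U t = 1 :=
  Matrix.mem_unitaryGroup_iff'.1 (hU t)

theorem mul_conjTranspose_self_eq_one (hU : ∀ t, U t ∈ Matrix.unitaryGroup (Fin d) ℂ) (t : Fin 2) :
    U t * (U t).conjTranspose = 1 :=
  Matrix.mem_unitaryGroup_iff.1 (hU t)

/-- Alice's outcome `M` depends on `(k, t)` only, with probability `M (k, t) (k, t)`. -/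
theorem trace_kronecker_mul_cq {b : Type} [Fintype b] (c : ℂ)
    (β : Fin d → Fin 2 → Matrix b b ℂ) (M : Matrix (Fin d × Fin 2) (Fin d × Fin 2) ℂ)
    (N : Matrix b b ℂ) :
    ((M ⊗ₖ N) * (c • ∑ k, ∑ t, (ketbra k ⊗ₖ ketbra t) ⊗ₖ β k t)).trace =
      ∑ j : Fin d × Fin 2, c * M j j * (N * β j.1 j.2).trace := by
  rw [Matrix.mul_smul, Matrix.trace_smul, smul_eq_mul, mul_sum, Matrix.trace_sum,
    Fintype.sum_prod_type, mul_sum]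
  refine sum_congr rfl fun k _ => ?_
  rw [mul_sum, Matrix.trace_sum, mul_sum]
  refine sum_congr rfl fun t _ => ?_
  rw [← Matrix.mul_kronecker_mul, Matrix.trace_kronecker, ketbra, ketbra,
    Matrix.single_kronecker_single, one_mul, Matrix.trace_mul_single]
  simp [mul_assoc]

theorem trace_kronecker_mul_cq_re {b : Type} [Fintype b] (β : Fin d → Fin 2 → Matrix b b ℂ)
    {M : Matrix (Fin d × Fin 2) (Fin d × Fin 2) ℂ} (hM : M.PosSemidef) (N : Matrix b b ℂ) :
    ((M ⊗ₖ N) * ((1 / (2 * (d : ℂ))) • ∑ k, ∑ t, (ketbra k ⊗ₖ ketbra t) ⊗ₖ β k t)).trace.re =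
      ∑ j : Fin d × Fin 2, 1 / (2 * (d : ℝ)) * (M j j).re * (N * β j.1 j.2).trace.re := by
  rw [trace_kronecker_mul_cq, Complex.re_sum]
  refine sum_congr rfl fun j _ => ?_
  have h : M j j = ((M j j).re : ℂ) := Complex.eq_re_of_ofReal_le hM.diag_nonneg
  have hc : (1 / (2 * (d : ℂ))) = ((1 / (2 * (d : ℝ)) : ℝ) : ℂ) := by push_cast; rfl
  rw [h, hc, ← Complex.ofReal_mul, Complex.re_ofReal_mul, Complex.ofReal_re]

theorem posSemidef_lockedState : (lockedState d U).PosSemidef := by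
  have hc : (0 : ℂ) ≤ 1 / (2 * (d : ℂ)) := by
    have : (0 : ℝ) ≤ 1 / (2 * (d : ℝ)) := by positivity
    simpa using Complex.zero_le_real.2 this
  refine Matrix.PosSemidef.smul (Matrix.posSemidef_sum _ fun k _ => Matrix.posSemidef_sum _
    fun t _ => ((posSemidef_single_one k).kronecker (posSemidef_single_one t)).kronecker
      ((posSemidef_single_one k).mul_mul_conjTranspose_same (U t))) hc

theorem trace_lockedState (hd : 0 < d) (hU : ∀ t, U t ∈ Matrix.unitaryGroup (Fin d) ℂ) :
    (lockedState d U).trace = 1 := by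
  have h := trace_kronecker_mul_cq (1 / (2 * (d : ℂ)))
    (fun k t => U t * ketbra k * (U t).conjTranspose) 1 1
  rw [Matrix.one_kronecker_one, Matrix.one_mul] at h
  have hd' : (d : ℂ) ≠ 0 := by exact_mod_cast hd.ne'
  refine h.trans ?_
  simp only [trace_mul_ketbra, Matrix.mul_one, conjTranspose_mul_self_eq_one hU, Matrix.one_apply_eq]
  simp
  field_simp

theorem mutualInfo_lockedState_le (hd : 0 < d) (hU : ∀ t, U t ∈ Matrix.unitaryGroup (Fin d) ℂ)
    (hU0 : U 0 = 1) (hconj : ∀ i k : Fin d, ‖U 1 i k‖ = 1 / √d) {m n : ℕ}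
    (M : POVM (Fin d × Fin 2) m) (N : POVM (Fin d) n) :
    mutualInfo (outcomeDist (lockedState d U) M N) ≤ 1 / 2 * Real.logb 2 d := by
  have hd' : (0 : ℝ) < d := by exact_mod_cast hd
  set q : Fin d × Fin 2 → Fin n → ℝ := fun j y =>
    (N.effect y * (U j.2 * ketbra j.1 * (U j.2).conjTranspose)).trace.re with hq
  have hout : outcomeDist (lockedState d U) M N =
      fun z => ∑ j, 1 / (2 * (d : ℝ)) * (M.effect z.1 j j).re * q j z.2 :=
    funext fun z => trace_kronecker_mul_cq_re _ (M.posSemidef z.1) _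
  have hq0 : ∀ j y, 0 ≤ q j y := fun j y => (Complex.nonneg_iff.1 (trace_mul_nonneg
    (N.posSemidef y) ((posSemidef_single_one j.1).mul_mul_conjTranspose_same (U j.2)))).1
  have hq1 : ∀ j, ∑ y, q j y = 1 := fun j => by
    rw [hq]
    simp only [← Complex.re_sum, ← Matrix.trace_sum, ← Matrix.sum_mul, N.sum_eq_one]
    rw [trace_mul_ketbra, Matrix.mul_one, conjTranspose_mul_self_eq_one hU, Matrix.one_apply_eq,
      Complex.one_re]
  have hw : ∀ j x, 0 ≤ (M.effect x j j).re := fun j x =>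
    (Complex.nonneg_iff.1 (M.posSemidef x).diag_nonneg).1
  have hw1 : ∀ j, ∑ x, (M.effect x j j).re = 1 := fun j => by
    rw [← Complex.re_sum, ← Matrix.sum_apply, M.sum_eq_one, Matrix.one_apply_eq, Complex.one_re]
  rw [hout]
  refine (mutualInfo_le_of_channel (1 / (2 * (d : ℝ))) (by positivity)
    (fun j x => (M.effect x j j).re) q hw hw1 hq0 hq1).trans ?_
  rw [Real.logb, ← mul_div_assoc]
  refine div_le_div_of_nonneg_right ?_ (Real.log_nonneg one_le_two)
  have hτ : ∀ t y, ∑ k, q (k, t) y = (N.effect y).trace.re := fun t y => by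
    simp only [hq, trace_mul_ketbra]
    rw [← Complex.re_sum]
    change (Matrix.trace ((U t).conjTranspose * N.effect y * U t)).re = _
    rw [Matrix.trace_mul_comm, ← Matrix.mul_assoc, mul_conjTranspose_self_eq_one hU, Matrix.one_mul]
  have hτsum : ∑ y, (N.effect y).trace.re = d := by
    rw [← Complex.re_sum, ← Matrix.trace_sum, N.sum_eq_one, Matrix.trace_one, Fintype.card_fin,
      Complex.natCast_re]
  have key : ∀ y, ∑ j, 1 / (2 * (d : ℝ)) * (q j y * (Real.log (q j y) -
      Real.log (∑ i, 1 / (2 * (d : ℝ)) * q i y))) ≤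
      (N.effect y).trace.re * (Real.log d / (2 * d)) := by
    intro y
    obtain ⟨B, hB⟩ := posSemidef_exists_eq (N.posSemidef y)
    have hqB : ∀ k t, ∑ x, ‖(B * U t) x k‖ ^ 2 = q (k, t) y := fun k t => by
      simp only [hq, trace_mul_ketbra, hB]
      rw [← Matrix.mul_assoc, ← Matrix.conjTranspose_mul, Matrix.mul_assoc, Matrix.mul_apply,
        Complex.re_sum]
      refine sum_congr rfl fun x _ => ?_
      rw [Matrix.conjTranspose_apply, RCLike.star_def, Complex.conj_mul', ← Complex.ofReal_pow,
        Complex.ofReal_re]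
    -- As `U 0 = 1`, the two bases are the computational one and the columns of `U 1`.
    have hMU := sum_mul_log_add_sum_mul_log_le B (hU 1) (c := 1 / √d) (by positivity)
      (fun i k => (hconj i k).le) (p := fun i => q (i, 0) y)
      (fun i => by rw [← hqB, hU0, Matrix.mul_one]) (fun k => hqB k 1) (hτ 0 y)
    set τ := (N.effect y).trace.re
    have hmarg : ∑ i, 1 / (2 * (d : ℝ)) * q i y = τ / d := by
      rw [← mul_sum, Fintype.sum_prod_type_right, Fin.sum_univ_two, hτ, hτ]
      field_simp
      ring
    rw [hmarg, ← mul_sum]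
    simp only [mul_sub, sum_sub_distrib, ← sum_mul]
    simp only [Fintype.sum_prod_type_right, Fin.sum_univ_two, hτ]
    have hτlog : τ * Real.log (τ / d) = τ * (Real.log τ - Real.log d) := by
      by_cases h : τ = 0
      · simp [h]
      · rw [Real.log_div h hd'.ne']
    rw [Real.log_div one_ne_zero (by positivity), Real.log_one, Real.log_sqrt hd'.le] at hMU
    rw [add_mul, hτlog, ← mul_sub]
    have : τ * (Real.log d / (2 * d)) = 1 / (2 * (d : ℝ)) * (τ * Real.log d) := by
      field_simp
    rw [this]
    refine mul_le_mul_of_nonneg_left ?_ (by positivity)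
    linarith
  refine (sum_le_sum fun y _ => key y).trans_eq ?_
  rw [← sum_mul, hτsum]
  field_simp

theorem half_logb_mem_localInfoValues_lockedState (hd : 0 < d) (hU0 : U 0 = 1)
    (hconj : ∀ i k : Fin d, ‖U 1 i k‖ = 1 / √d) :
    1 / 2 * Real.logb 2 d ∈ localInfoValues (lockedState d U) := by
  have hd' : (0 : ℝ) < d := by exact_mod_cast hd
  have h := mutualInfo_mem_localInfoValues (lockedState d U)
    (fun j : Fin d × Fin 2 => Matrix.single j j 1) (fun y : Fin d => Matrix.single y y 1)
    posSemidef_single_one posSemidef_single_one sum_single_one sum_single_one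
  -- For `t = 0` Bob's outcome equals `k`; for `t = 1` it is uniform and independent of `k`, because
  -- the entries of `U 1` have equal modulus. Only the first half carries information.
  have hdist : (fun z : (Fin d × Fin 2) × Fin d =>
      ((Matrix.single z.1 z.1 1 ⊗ₖ Matrix.single z.2 z.2 1) * lockedState d U).trace.re) =
      fun z => if z.1.2 = 0 then (if z.2 = z.1.1 then 1 / (2 * (d : ℝ)) else 0)
        else 1 / (2 * (d : ℝ)) * (1 / d) := by
    ext ⟨⟨k, t⟩, y⟩
    refine (trace_kronecker_mul_cq_re _ (posSemidef_single_one (k, t)) _).trans ?_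
    rw [sum_eq_single (k, t) (fun j _ hj => by simp [hj.symm]) (by simp)]
    have hV : ((U t).conjTranspose * Matrix.single y y (1 : ℂ) * U t) k k =
        ((‖U t y k‖ ^ 2 : ℝ) : ℂ) := by
      rw [Matrix.mul_apply, sum_eq_single y (fun i _ hi => by
        simp [Matrix.mul_apply, hi.symm]) (by simp)]
      simp [Matrix.mul_apply, Matrix.single_apply, Complex.conj_mul']
    rw [trace_mul_ketbra, hV, Complex.ofReal_re]
    fin_cases t
    · by_cases hyk : y = k <;> simp [hU0, hyk]
    · simp [hconj]
  rw [hdist] at h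
  convert h using 1
  have hc : (0 : ℝ) < 1 / (2 * (d : ℝ)) := by positivity
  have hcd : (d : ℝ) * (1 / (2 * (d : ℝ))) = 1 / 2 := by field_simp
  rw [mutualInfo_eq, Real.logb, ← mul_div_assoc]
  congr 1
  have hA : ∀ x : Fin d × Fin 2, (∑ y : Fin d, if x.2 = 0 then
      (if y = x.1 then 1 / (2 * (d : ℝ)) else 0) else 1 / (2 * (d : ℝ)) * (1 / d)) =
      1 / (2 * (d : ℝ)) := by
    rintro ⟨k, t⟩
    fin_cases t
    · simp
    · simp
      field_simp
  have hB : ∀ y : Fin d, (∑ x : Fin d × Fin 2, if x.2 = 0 then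
      (if y = x.1 then 1 / (2 * (d : ℝ)) else 0) else 1 / (2 * (d : ℝ)) * (1 / d)) =
      1 / d := by
    intro y
    rw [Fintype.sum_prod_type_right]
    simp
    field_simp
    norm_num
  simp only [hA, hB, Fintype.sum_prod_type_right, Fin.sum_univ_two]
  have hlog : Real.log (1 / (2 * (d : ℝ)) * (1 / d)) - Real.log (1 / (2 * (d : ℝ))) -
      Real.log (1 / d) = 0 := by
    rw [Real.log_mul hc.ne' (by positivity)]
    ring
  have hlogd : Real.log (1 / (d : ℝ)) = -Real.log d := by rw [one_div, Real.log_inv]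
  simp only [one_ne_zero, if_true, if_false, hlog, mul_zero, sum_const_zero, add_zero]
  simp only [ite_mul, zero_mul, sum_ite_eq', mem_univ, if_true, sub_self, zero_sub, hlogd, neg_neg]
  rw [sum_const, card_univ, Fintype.card_fin, nsmul_eq_mul, ← mul_assoc, hcd]

end LockedState

/-! ### The state after the bit is sent: `I_c = log d + 1` -/

section UnlockedState

variable {d : ℕ} {U : Fin 2 → Matrix (Fin d) (Fin d) ℂ}

theorem sendBit_apply_lockedState :
    (sendBit d).apply (lockedState d U) = unlockedState d U := by
  let V : Fin 2 → Matrix (Fin d × Fin 2) (Fin d) ℂ := fun t =>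
    Matrix.of fun z j => if z = (j, t) then 1 else 0
  let K : Fin 2 → Matrix (Fin d × Fin 2) (Fin d × Fin 2) ℂ := fun t => 1 ⊗ₖ ketbra t
  have hstore : ∀ (t : Fin 2) (X : Matrix (Fin d) (Fin d) ℂ),
      V t * X * (V t).conjTranspose = X ⊗ₖ ketbra t := by
    intro t X
    ext ⟨i, s⟩ ⟨j, u⟩
    by_cases hs : s = t
    · by_cases hu : u = t
      · simp [V, ketbra, Matrix.mul_apply, hs, hu]
      · simp [V, ketbra, Matrix.mul_apply, hu, Ne.symm hu]
    · simp [V, ketbra, Matrix.mul_apply, hs, Ne.symm hs]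
  have hread : ∀ (s : Fin 2) (k : Fin d) (t : Fin 2),
      K s * (ketbra k ⊗ₖ ketbra t) * (K s).conjTranspose =
        if s = t then ketbra k ⊗ₖ ketbra t else 0 := by
    intro s k t
    simp only [K, Matrix.conjTranspose_kronecker, ← Matrix.mul_kronecker_mul,
      Matrix.conjTranspose_one, Matrix.one_mul, Matrix.mul_one]
    split_ifs with h
    · subst h
      simp [ketbra]
    · simp [ketbra, h]
  -- Alice's reading `s` annihilates every term with `t ≠ s`, so Bob stores the true `t`.
  have hterm : ∀ (s : Fin 2) (k : Fin d) (t : Fin 2) (X : Matrix (Fin d) (Fin d) ℂ),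
      (K s ⊗ₖ V s) * ((ketbra k ⊗ₖ ketbra t) ⊗ₖ X) * (K s ⊗ₖ V s).conjTranspose =
      if s = t then (ketbra k ⊗ₖ ketbra t) ⊗ₖ (X ⊗ₖ ketbra t) else 0 := by
    intro s k t X
    rw [Matrix.conjTranspose_kronecker, ← Matrix.mul_kronecker_mul, ← Matrix.mul_kronecker_mul,
      hread, hstore]
    split_ifs with h
    · rw [h]
    · rw [Matrix.zero_kronecker]
  change ∑ s, ∑ _i : Fin 1, ∑ _j : Fin 1, (K s ⊗ₖ V s) * lockedState d U *
    (K s ⊗ₖ V s).conjTranspose = _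
  simp only [Fin.sum_univ_one, lockedState, unlockedState, Matrix.mul_smul, Matrix.smul_mul,
    Matrix.mul_sum, Matrix.sum_mul]
  rw [← smul_sum, sum_comm]
  refine congrArg _ (sum_congr rfl fun k _ => ?_)
  rw [sum_comm]
  refine sum_congr rfl fun t _ => ?_
  rw [sum_congr rfl fun s _ => hterm s k t _]
  simp

theorem logb_two_mul_mem_localInfoValues_unlockedState (hd : 0 < d)
    (hU : ∀ t, U t ∈ Matrix.unitaryGroup (Fin d) ℂ) :
    Real.logb 2 (2 * d) ∈ localInfoValues (unlockedState d U) := by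
  have hd' : (0 : ℝ) < d := by exact_mod_cast hd
  have hsum : ∑ j : Fin d × Fin 2, (U j.2 * ketbra j.1 * (U j.2).conjTranspose) ⊗ₖ ketbra j.2 =
      1 := by
    have hk : ∀ t, ∑ k, U t * ketbra k * (U t).conjTranspose = 1 := fun t => by
      rw [← Matrix.sum_mul, ← Matrix.mul_sum]
      simp only [ketbra]
      rw [sum_single_one, Matrix.mul_one, mul_conjTranspose_self_eq_one hU]
    rw [Fintype.sum_prod_type_right, ← Matrix.one_kronecker_one, ← sum_single_one (n := Fin 2)]
    ext ⟨i, i'⟩ ⟨j, j'⟩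
    simp only [Matrix.kronecker_apply, Matrix.sum_apply, mul_sum]
    refine sum_congr rfl fun t _ => ?_
    rw [← sum_mul, ← Matrix.sum_apply, hk, ketbra]
  have h := mutualInfo_mem_localInfoValues (unlockedState d U)
    (fun j : Fin d × Fin 2 => Matrix.single j j 1)
    (fun j : Fin d × Fin 2 => (U j.2 * ketbra j.1 * (U j.2).conjTranspose) ⊗ₖ ketbra j.2)
    posSemidef_single_one
    (fun j => ((posSemidef_single_one j.1).mul_mul_conjTranspose_same (U j.2)).kronecker
      (posSemidef_single_one j.2)) sum_single_one hsum
  -- Bob measures in the orthonormal basis `U_t |k⟩ ⊗ |t⟩`, so the outcomes agree and are uniform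
  -- over `2d` values.
  have hdist : (fun z : (Fin d × Fin 2) × (Fin d × Fin 2) => ((Matrix.single z.1 z.1 1 ⊗ₖ
      ((U z.2.2 * ketbra z.2.1 * (U z.2.2).conjTranspose) ⊗ₖ ketbra z.2.2)) *
        unlockedState d U).trace.re) =
      fun z => if z.1 = z.2 then 1 / (2 * (d : ℝ)) else 0 := by
    ext ⟨⟨k, t⟩, ⟨l, s⟩⟩
    refine (trace_kronecker_mul_cq_re _ (posSemidef_single_one (k, t)) _).trans ?_
    rw [sum_eq_single (k, t) (fun j _ hj => by simp [hj.symm]) (by simp)]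
    rw [← Matrix.mul_kronecker_mul, Matrix.trace_kronecker, trace_mul_ketbra]
    by_cases hst : s = t
    · subst hst
      have : (U s).conjTranspose * (U s * ketbra l * (U s).conjTranspose) * U s = ketbra l := by
        simp only [← Matrix.mul_assoc, conjTranspose_mul_self_eq_one hU, Matrix.one_mul]
        rw [Matrix.mul_assoc, conjTranspose_mul_self_eq_one hU, Matrix.mul_one]
      rw [this]
      by_cases hkl : k = l
      · simp [ketbra, hkl]
      · simp [ketbra, hkl, Ne.symm hkl]
    · simp [ketbra, hst, Ne.symm hst]
  rw [hdist] at h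
  convert h using 1
  rw [mutualInfo_eq, Real.logb]
  congr 1
  simp only [sum_ite_eq, sum_ite_eq', mem_univ, if_true, ite_mul, zero_mul, sub_self, zero_sub]
  rw [sum_const, card_univ, Fintype.card_prod, Fintype.card_fin, Fintype.card_fin, nsmul_eq_mul,
    one_div, Real.log_inv, Nat.cast_mul]
  push_cast
  field_simp

end UnlockedState

theorem isGreatest_csSup_of_mem {s : Set ℝ} {v : ℝ} (hv : v ∈ s) (hle : ∀ w ∈ s, w ≤ v) :
    IsGreatest s (sSup s) ∧ sSup s = v := by
  have h : IsGreatest s v := ⟨hv, hle⟩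
  exact ⟨h.csSup_eq.symm ▸ h, h.csSup_eq⟩

end Locking

theorem mainTheorem1 (d : ℕ) (hd : 0 < d) (U : Fin 2 → Matrix (Fin d) (Fin d) ℂ)
    (hU0 : U 0 = 1) (hU1 : U 1 ∈ Matrix.unitaryGroup (Fin d) ℂ)
    (hconj : ∀ i k : Fin d, ‖U 1 i k‖ = 1 / Real.sqrt d) :
    (IsGreatest (Locking.localInfoValues (Locking.lockedState d U))
        (Locking.Ic (Locking.lockedState d U)) ∧
      Locking.Ic (Locking.lockedState d U) = 1 / 2 * Real.logb 2 d) ∧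
    ((Locking.sendBit d).apply (Locking.lockedState d U) = Locking.unlockedState d U ∧
      IsGreatest (Locking.localInfoValues (Locking.unlockedState d U))
        (Locking.Ic (Locking.unlockedState d U)) ∧
      Locking.Ic (Locking.unlockedState d U) = Real.logb 2 d + 1) ∧
    (IsGreatest (Locking.oneBitValues (Locking.lockedState d U))
        (Locking.IcOneBit (Locking.lockedState d U)) ∧
      Locking.IcOneBit (Locking.lockedState d U) = Real.logb 2 d + 1) ∧
    (Locking.Ic (Locking.unlockedState d U) - Locking.Ic (Locking.lockedState d U) =
        1 + 1 / 2 * Real.logb 2 d ∧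
      Locking.IcOneBit (Locking.lockedState d U) - Locking.Ic (Locking.lockedState d U) =
        1 + 1 / 2 * Real.logb 2 d) := by
  have hU : ∀ t, U t ∈ Matrix.unitaryGroup (Fin d) ℂ :=
    Fin.forall_fin_two.2 ⟨hU0 ▸ one_mem _, hU1⟩
  have hd' : (1 : ℝ) ≤ d := by exact_mod_cast hd
  have hlog : Real.logb 2 (2 * d) = Real.logb 2 d + 1 := by
    rw [Real.logb_mul two_ne_zero (by positivity), Real.logb_self_eq_one one_lt_two, add_comm]
  have hlocked := Locking.isGreatest_csSup_of_mem
    (Locking.half_logb_mem_localInfoValues_lockedState hd hU0 hconj) (by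
      rintro _ ⟨m, n, M, N, rfl⟩
      exact Locking.mutualInfo_lockedState_le hd hU hU0 hconj M N)
  have hle : ∀ {a b : Type} [Fintype a] [DecidableEq a] [Fintype b] [DecidableEq b]
      (P : Locking.OneBitProtocol (Fin d × Fin 2) (Fin d) a b),
      ∀ v ∈ Locking.localInfoValues (P.apply (Locking.lockedState d U)),
        v ≤ Real.logb 2 d + 1 := by
    rintro a b _ _ _ _ P _ ⟨m, n, M, N, rfl⟩
    rw [← hlog]
    simpa using Locking.mutualInfo_outcomeDist_apply_le Locking.posSemidef_lockedState
      (Locking.trace_lockedState hd hU) P M N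
  have hsend := Locking.sendBit_apply_lockedState (d := d) (U := U)
  have hunlocked := Locking.isGreatest_csSup_of_mem
    (hlog ▸ Locking.logb_two_mul_mem_localInfoValues_unlockedState hd hU)
    (hsend ▸ hle (Locking.sendBit d))
  have honebit : IsGreatest (Locking.oneBitValues (Locking.lockedState d U))
        (Locking.IcOneBit (Locking.lockedState d U)) ∧
      Locking.IcOneBit (Locking.lockedState d U) = Real.logb 2 d + 1 := by
    refine Locking.isGreatest_csSup_of_mem ⟨Fin d × Fin 2, Fin d × Fin 2, inferInstance, inferInstance,
      inferInstance, inferInstance, Locking.sendBit d, ?_⟩ ?_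
    · rw [hsend]
      exact hunlocked.2
    · rintro _ ⟨a, b, _, _, _, _, P, rfl⟩
      -- Nonnegativity of the bound also covers the convention `sSup ∅ = 0`, so nonemptiness need
      -- not be checked for each protocol.
      exact Real.sSup_le (hle P) (add_nonneg (Real.logb_nonneg one_lt_two hd') zero_le_one)
  refine ⟨hlocked, ⟨hsend, hunlocked⟩, honebit, ?_, ?_⟩
  · rw [Locking.Ic, Locking.Ic, hunlocked.2, hlocked.2]
    ring
  · rw [honebit.2, Locking.Ic, hlocked.2]
    ring
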